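/- **Setting.** Let $a_1,\dots,a_n\in\mathbb R^d$ be data points with a hidden partition into $K$ non-empty clusters $\mathcal V=\{V_1,\dots,V_K\}$; let $I_\alpha$ be the set of indices $i$ with $a_i$ in $V_\alpha$, and $n_\alpha=|I_\alpha|$. Let $w_{ij}=w_{ji}\ge 0$ $(i\ne j)$ be weights. Put $$a^{(0)}=\tfrac1n\sum_i a_i,\quad a^{(\alpha)}=\tfrac1{n_\alpha}\sum_{i\in I_\alpha}a_i,\quad w_i^{(\beta)}=\sum_{j\in I_\beta}w_{ij},\quad \bar w^{(\beta)}=\tfrac1{n_\beta}\sum_{l\ne\beta}\sum_{i\in I_\beta}\sum_{j\in I_l}w_{ij},\quad \mu_{ij}^{(\alpha)}=\sum_{\beta\neq\alpha}|w_i^{(\beta)}-w_j^{(\beta)}| .$$ Assume that $a^{(0)},a^{(1)},\dots,a^{(K)}$ are all distinct, that $w_{ij}>0$ and $n_\alpha w_{ij}>\mu_{ij}^{(\alpha)}$ for all $\alpha$ and all $i\neq j$ in $I_\alpha$, and that $n>K(K+1)$. With values in $[0,\infty]$ (where $x/0=\infty$ for $x>0$) put $$\gamma_{\min}=\max_{\alpha}\max_{i,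 j\in I_\alpha,\, i\ne j}\frac{\|a_i-a_j\|}{n_\alpha w_{ij}-\mu_{ij}^{(\alpha)}},\quad \gamma_{\max}=\min_{\alpha<\beta}\frac{\|a^{(\alpha)}-a^{(\beta)}\|}{\bar w^{(\alpha)}+\bar w^{(\beta)}},\quad \gamma_{\max 2}=\max_\alpha\frac{\|a^{(0)}-a^{(\alpha)}\|}{\bar w^{(\alpha)}},$$ where an empty maximum is $0$, and $r=\gamma_{\max}/\gamma_{\min}$, $r_2=\gamma_{\max2}/\gamma_{\min}$. For a matrix $\Pi\in\mathbb R^{m\times d}$ and $\gamma\ge0$, let $\hat x_1,\dots,\hat x_n\in\mathbb R^m$ be the (unique) optimal solution of the projected convex clustering model $$\min_{x_1,\dots,x_n\in\mathbb R^m}\ \tfrac12\sum_{i}\|x_i-\Pi a_i\|^2+\gamma\sum_{i<j}w_{ij}\|x_i-x_j\| ,$$ and $\hat\phi_\gamma(a_i)=\hat x_i$. The map $\hat\phi_\gamma$ *perfectly recovers* $\mathcal V$ if, for all $i,j$, $\hat x_i=\hat x_j$ exactly when $a_i,a_j$ are in the same cluster. It *recovers a non-trivial coarsening* of $\mathcal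 V$ if the clusters can be put into $L>1$ non-empty groups such that, for all $i,j$, $\hat x_i=\hat x_j$ exactly when the clusters of $a_i$ and $a_j$ are in the same group. A probability distribution on $\mathbb R^{m\times d}$ is a *DJL distribution* with parameters $(\epsilon,\delta)$ if $\mathbb P\big[\,|\|\Pi z\|^2-1|>\epsilon\,\big]<\delta$ for every unit vector $z\in\mathbb R^d$. **Theorem.** (0) There is an absolute constant $C_0>0$ such that for all integers $n\ge2$, $d\ge 0$ and all real $p>2$, $0<\epsilon<1$ there is a DJL distribution on $\mathbb R^{m\times d}$ with parameters $(\epsilon,2/n^p)$ for some $m\le C_0\,p\,\epsilon^{-2}\log n$. Now let $C>0$ be any constant (the constant of the bound $m=O(p\epsilon^{-2}\log n)$), let $p>2$ be real, put $\epsilon_{\min}=\sqrt{Cp\log(n)/d}$, and assume $\epsilon_{\min}<1$. Put $\epsilon_{\sup}=\frac{r^2-1}{r^2+1}$ and $\epsilon_{\sup2}=\frac{r_2^2-1}{r_2^2+1}$ (read as $1$ if $r=\infty$, respectively $r_2=\infty$). (1) If $r>\sqrt{\frac{1+\epsilon_{\min}}{1-\epsilon_{\min}}}$, then $\epsilon_{\min}<\epsilon_{\sup}$.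 Moreover, for every $\epsilon\in[\epsilon_{\min},\epsilon_{\sup})$, every $m\le Cp\epsilon^{-2}\log n$, every DJL distribution on $\mathbb R^{m\times d}$ with parameters $(\epsilon,2/n^p)$, and every real $\hat\gamma\ge0$ in $[\sqrt{1+\epsilon}\,\gamma_{\min},\sqrt{1-\epsilon}\,\gamma_{\max})$: if $\Pi$ is drawn from this distribution, then with probability greater than $1-\frac1{n^{p-2}}$ the map $\hat\phi_{\hat\gamma}$ perfectly recovers $\mathcal V$. (2) If $r_2>\sqrt{\frac{1+\epsilon_{\min}}{1-\epsilon_{\min}}}$, then $\epsilon_{\min}<\epsilon_{\sup2}$. Moreover, for every $\epsilon\in[\epsilon_{\min},\epsilon_{\sup2})$, every $m\le Cp\epsilon^{-2}\log n$, every DJL distribution on $\mathbb R^{m\times d}$ with parameters $(\epsilon,2/n^p)$, and every real $\hat\gamma\ge0$ in $[\sqrt{1+\epsilon}\,\gamma_{\min},\sqrt{1-\epsilon}\,\gamma_{\max2})$: if $\Pi$ is drawn from this distribution, then with probability greater than $1-\frac1{n^{p-2}}$ the map $\hat\phi_{\hat\gamma}$ recovers a non-trivial coarsening of $\mathcal V$.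 -/

import Mathlib

open MeasureTheory
open scoped ENNReal

noncomputable section

namespace ConvexClustering

/-! Throughout, `a : Fin n → ℝ^d` is the data and the hidden partition into `K` clusters is
given by the labelling `c : Fin n → Fin K` (surjective in the theorem, so that no cluster is
empty): `a i` belongs to the cluster `V_(c i)`. -/

section Clusters

variable {n d K : ℕ}

/-- The index set `I_α` of the cluster `α`. -/
def idx (c : Fin n → Fin K) (α : Fin K) : Finset (Fin n) :=
  Finset.univ.filter fun i => c i = α

/-- The overall mean `a^(0)`. -/
def mean (a : Fin n → EuclideanSpace ℝ (Fin d)) : EuclideanSpace ℝ (Fin d) :=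
  (n : ℝ)⁻¹ • ∑ i, a i

/-- The centroid `a^(α)` of the cluster `α`. -/
def centroid (a : Fin n → EuclideanSpace ℝ (Fin d)) (c : Fin n → Fin K) (α : Fin K) :
    EuclideanSpace ℝ (Fin d) :=
  ((idx c α).card : ℝ)⁻¹ • ∑ i ∈ idx c α, a i

/-- `w_i^(β)`, the total weight between the index `i` and the cluster `β`. -/
def wPoint (w : Fin n → Fin n → ℝ) (c : Fin n → Fin K) (i : Fin n) (β : Fin K) : ℝ :=
  ∑ j ∈ idx c β, w i j

/-- `w^(α,β)`, the total weight between the clusters `α` and `β`. -/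
def wPair (w : Fin n → Fin n → ℝ) (c : Fin n → Fin K) (α β : Fin K) : ℝ :=
  ∑ i ∈ idx c α, ∑ j ∈ idx c β, w i j

/-- The averaged outgoing weight of the cluster `β`. -/
def wBar (w : Fin n → Fin n → ℝ) (c : Fin n → Fin K) (β : Fin K) : ℝ :=
  ((idx c β).card : ℝ)⁻¹ * ∑ l ∈ Finset.univ.erase β, wPair w c β l

/-- `μ_ij^(α)`, for `i`, `j` in the cluster `α`. -/
def mu (w : Fin n → Fin n → ℝ) (c : Fin n → Fin K) (α : Fin K) (i j : Fin n) : ℝ :=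
  ∑ β ∈ Finset.univ.erase α, |wPoint w c i β - wPoint w c j β|

/-- `γ_min`. The parameters `γ_min`, `γ_max`, `γ_max2` and the ratios `r`, `r₂` take values in
`[0, ∞]`, where `x / 0 = ∞` for `x > 0`; the terms with `i = j` are `0`. -/
def gammaMin (a : Fin n → EuclideanSpace ℝ (Fin d)) (w : Fin n → Fin n → ℝ)
    (c : Fin n → Fin K) : ℝ≥0∞ :=
  ⨆ α : Fin K, ⨆ i ∈ idx c α, ⨆ j ∈ idx c α,
    ENNReal.ofReal ‖a i - a j‖ /
      ENNReal.ofReal (((idx c α).card : ℝ) * w i j - mu w c α i j)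

/-- `γ_max`. -/
def gammaMax (a : Fin n → EuclideanSpace ℝ (Fin d)) (w : Fin n → Fin n → ℝ)
    (c : Fin n → Fin K) : ℝ≥0∞ :=
  ⨅ α : Fin K, ⨅ β : Fin K, ⨅ _ : α < β,
    ENNReal.ofReal ‖centroid a c α - centroid a c β‖ /
      ENNReal.ofReal (wBar w c α + wBar w c β)

/-- `γ_max2`. -/
def gammaMax2 (a : Fin n → EuclideanSpace ℝ (Fin d)) (w : Fin n → Fin n → ℝ)
    (c : Fin n → Fin K) : ℝ≥0∞ :=
  ⨆ α : Fin K,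
    ENNReal.ofReal ‖mean a - centroid a c α‖ / ENNReal.ofReal (wBar w c α)

/-- `r = γ_max / γ_min`. -/
def ratio (a : Fin n → EuclideanSpace ℝ (Fin d)) (w : Fin n → Fin n → ℝ)
    (c : Fin n → Fin K) : ℝ≥0∞ :=
  gammaMax a w c / gammaMin a w c

/-- `r₂ = γ_max2 / γ_min`. -/
def ratio2 (a : Fin n → EuclideanSpace ℝ (Fin d)) (w : Fin n → Fin n → ℝ)
    (c : Fin n → Fin K) : ℝ≥0∞ :=
  gammaMax2 a w c / gammaMin a w c

end Clusters

/-- `(r² - 1) / (r² + 1)`, equal to its limit `1` at `r = ∞`. -/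
def epsSup (r : ℝ≥0∞) : ℝ :=
  if r = ∞ then 1 else (r.toReal ^ 2 - 1) / (r.toReal ^ 2 + 1)

/-- `ε_min = √(C p log n / d)`, where `C` is the constant of the bound on the dimension `m`. -/
def epsMin (C p : ℝ) (n d : ℕ) : ℝ :=
  Real.sqrt (C * p * Real.log n / d)

section Model

variable {n d K : ℕ}

/-- The objective function of the (weighted) convex clustering model with data `b`. -/
def objective (b : Fin n → EuclideanSpace ℝ (Fin d)) (w : Fin n → Fin n → ℝ) (γ : ℝ)
    (x : Fin n → EuclideanSpace ℝ (Fin d)) : ℝ :=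
  (1 / 2) * ∑ i, ‖x i - b i‖ ^ 2 + γ * ∑ i, ∑ j ∈ Finset.univ.filter (fun j => i < j),
    w i j * ‖x i - x j‖

/-- `x` is the optimal solution of the convex clustering model with data `b`: it is a global
minimizer of the objective, and the only one. -/
def IsOptimalSolution (b : Fin n → EuclideanSpace ℝ (Fin d)) (w : Fin n → Fin n → ℝ) (γ : ℝ)
    (x : Fin n → EuclideanSpace ℝ (Fin d)) : Prop :=
  ∀ y, IsMinOn (objective b w γ) Set.univ y ↔ y = x

/-- The map `a i ↦ x i` perfectly recovers the partition with labelling `c`. -/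
def PerfectlyRecovers {L : ℕ} (x : Fin n → EuclideanSpace ℝ (Fin d)) (c : Fin n → Fin L) :
    Prop :=
  ∀ i j, x i = x j ↔ c i = c j

/-- The map `a i ↦ x i` recovers a non-trivial coarsening of the partition with labelling `c`:
for some `L > 1` and some partition of the `K` clusters into `L` non-empty groups (given by the
surjection `g`), it perfectly recovers the partition of the data into the unions of the clusters
of each group. -/
def RecoversNontrivialCoarsening (x : Fin n → EuclideanSpace ℝ (Fin d)) (c : Fin n → Fin K) :
    Prop :=
  ∃ L : ℕ, 1 < L ∧ ∃ g : Fin K → Fin L, Function.Surjective g ∧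
    PerfectlyRecovers x (g ∘ c)

end Model

section Projection

variable {m n d K : ℕ}

/-- The vector `P z`, for a real `m × d` matrix `P` given by its array of entries. -/
def project (P : Fin m → Fin d → ℝ) (z : EuclideanSpace ℝ (Fin d)) : EuclideanSpace ℝ (Fin m) :=
  Matrix.toEuclideanLin (Matrix.of P) z

/-- `D` is a DJL distribution over the real `m × d` matrices, with parameters `ε` and `δ`. -/
structure IsDJL (D : Measure (Fin m → Fin d → ℝ)) (ε δ : ℝ) : Prop where
  isProbabilityMeasure : IsProbabilityMeasure D
  distortion : ∀ z : EuclideanSpace ℝ (Fin d), ‖z‖ = 1 →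
    D.real {P | ε < |‖project P z‖ ^ 2 - 1|} < δ

/-- The set of all `m × d` matrices `P` for which the solution of the projected model, that is the
convex clustering model with data `P a_1, …, P a_n`, perfectly recovers the partition. -/
def recoveryEvent (m : ℕ) (a : Fin n → EuclideanSpace ℝ (Fin d)) (w : Fin n → Fin n → ℝ)
    (c : Fin n → Fin K) (γ : ℝ) : Set (Fin m → Fin d → ℝ) :=
  {P | ∃ x, IsOptimalSolution (fun i => project P (a i)) w γ x ∧ PerfectlyRecovers x c}

/-- The set of all `m × d` matrices `P` for which the solution of the projected model recovers a
non-trivial coarsening of the partition. -/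
def coarseRecoveryEvent (m : ℕ) (a : Fin n → EuclideanSpace ℝ (Fin d)) (w : Fin n → Fin n → ℝ)
    (c : Fin n → Fin K) (γ : ℝ) : Set (Fin m → Fin d → ℝ) :=
  {P | ∃ x, IsOptimalSolution (fun i => project P (a i)) w γ x ∧
    RecoversNontrivialCoarsening x c}

end Projection

end ConvexClustering

end

/-!
The existence of DJL distributions is the Johnson–Lindenstrauss lemma for matrices with independent
Gaussian entries (`exists_isDJL`): for a unit vector `z`, the number `m ‖P z‖²` is a sum of `m`
squares of independent standard normal variables, and the Chernoff bound gives the concentration.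

For the recovery, the projected data `b i = P (a i)` are treated deterministically. If
`‖b i - b j‖ ≤ γ (n_α w i j - μ i j)` inside the clusters, then replacing all points by the centroids
of their clusters does not increase the objective (`objective_centroid_le`), so that its minimizer
is constant on the clusters. Moving one cluster as a whole in the direction of the centroid of its
data shows that its optimal value is within `γ w̄^(α)` of that centroid (`norm_sub_centroid_le`).
Hence two clusters with `γ (w̄^(α) + w̄^(β)) < ‖b^(α) - b^(β)‖` are not merged, and if
`γ w̄^(α) < ‖b^(0) - b^(α)‖` for some `α`, then not all clusters are merged, because the common value
would be the mean `b^(0)`.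

These inequalities follow from the hypotheses on `γ` as soon as `P` preserves, up to the factors
`√(1 ± ε)`, the lengths of the differences of data points, of centroids, and of the mean and the
centroids. As `n > K (K + 1)`, there are fewer than `n² / 2` such vectors, and the union bound
(`IsDJL.one_sub_lt_real_of_testVectors`) gives a failure probability below `n² / n ^ p`.
-/

open MeasureTheory
open scoped ENNReal

noncomputable section

namespace ConvexClustering

/-! ### Gaussian random projections -/

section Gaussian

open ProbabilityTheory Real

/-- The moment generating function of the centred square of a standard Gaussian. -/
lemma integral_exp_sq_sub_one_gaussianReal {t : ℝ} (ht : t < 1 / 2) :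
    ∫ x, exp (t * (x ^ 2 - 1)) ∂gaussianReal 0 1 = exp (-t) * √(1 / (1 - 2 * t)) := by
  rw [integral_gaussianReal_eq_integral_smul one_ne_zero]
  have h : ∀ x : ℝ, gaussianPDFReal 0 1 x • exp (t * (x ^ 2 - 1))
      = ((√(2 * π))⁻¹ * exp (-t)) * exp (-(1 / 2 - t) * x ^ 2) := by
    intro x
    simp only [gaussianPDFReal, smul_eq_mul, NNReal.coe_one, mul_one, sub_zero]
    rw [mul_assoc, mul_assoc, ← exp_add, ← exp_add]
    ring_nf
  simp_rw [h]
  rw [integral_const_mul, integral_gaussian, mul_comm (√(2 * π))⁻¹, mul_assoc]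
  congr 1
  rw [inv_mul_eq_div, ← sqrt_div (by positivity)]
  congr 1
  have : 1 - 2 * t ≠ 0 := by linarith
  have : 1 / 2 - t ≠ 0 := by linarith
  have := pi_ne_zero
  field_simp

lemma integrable_exp_sq_sub_one_gaussianReal {t : ℝ} (ht : t < 1 / 2) :
    Integrable (fun x => exp (t * (x ^ 2 - 1))) (gaussianReal 0 1) := by
  refine Integrable.of_integral_ne_zero ?_
  rw [integral_exp_sq_sub_one_gaussianReal ht]
  have : 0 < 1 - 2 * t := by linarith
  positivity

lemma integral_exp_sq_sub_one_gaussianReal_le {t : ℝ} (ht : |t| ≤ 1 / 4) :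
    ∫ x, exp (t * (x ^ 2 - 1)) ∂gaussianReal 0 1 ≤ exp (4 * t ^ 2) := by
  have ht' := abs_le.1 ht
  have hpos : 0 < 1 - 2 * t := by linarith
  rw [integral_exp_sq_sub_one_gaussianReal (by linarith)]
  have hu : |2 * t| ≤ 1 / 2 := by rw [abs_mul, abs_two]; linarith
  have hlog : -(2 * t) - 8 * t ^ 2 ≤ log (1 - 2 * t) := by
    have h1 := abs_log_sub_add_sum_range_le (x := 2 * t) (by linarith) 1
    simp only [Finset.sum_range_one, zero_add, pow_one, Nat.cast_zero, div_one] at h1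
    have h2 : |2 * t| ^ (1 + 1) / (1 - |2 * t|) ≤ 8 * t ^ 2 := by
      rw [div_le_iff₀ (by linarith), sq_abs]
      nlinarith [sq_nonneg t]
    have := (abs_le.1 (h1.trans h2)).1
    linarith
  rw [← exp_log (show 0 < √(1 / (1 - 2 * t)) by positivity), ← exp_add, exp_le_exp,
    log_sqrt (by positivity), log_div one_ne_zero hpos.ne', log_one]
  linarith

/-- A linear functional given by a unit vector has the standard normal law under the standard
Gaussian measure. -/
lemma map_inner_stdGaussian {d : ℕ} {z : EuclideanSpace ℝ (Fin d)} (hz : ‖z‖ = 1) :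
    (stdGaussian (EuclideanSpace ℝ (Fin d))).map (fun g => inner ℝ z g) = gaussianReal 0 1 := by
  have h := IsGaussian.map_eq_gaussianReal (μ := stdGaussian (EuclideanSpace ℝ (Fin d)))
    (innerSL ℝ z)
  rw [variance_dual_stdGaussian, integral_strongDual_stdGaussian, innerSL_apply_norm, hz] at h
  simpa using h

/-- The sum of `m` independent copies of `s (X² - 1)`, with `X` standard normal and `s = ± 1`,
exceeds `m ε` with probability at most `exp (- m ε² / 16)`. -/
lemma pi_stdGaussian_tail {m d : ℕ} {z : EuclideanSpace ℝ (Fin d)} (hz : ‖z‖ = 1) {ε s : ℝ}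
    (hε : 0 < ε) (hε1 : ε < 1) (hs : |s| = 1) :
    (Measure.pi fun _ : Fin m => stdGaussian (EuclideanSpace ℝ (Fin d))).real
      {G | m * ε ≤ ∑ i, s * (inner ℝ z (G i) ^ 2 - 1)} ≤ exp (-(m * ε ^ 2 / 16)) := by
  set ν := stdGaussian (EuclideanSpace ℝ (Fin d))
  set Y : EuclideanSpace ℝ (Fin d) → ℝ := fun g => s * (inner ℝ z g ^ 2 - 1) with hY
  have hYm : Measurable Y := by fun_prop
  set X : Fin m → (Fin m → EuclideanSpace ℝ (Fin d)) → ℝ := fun i G => Y (G i) with hX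
  have hXm : ∀ i, Measurable (X i) := fun i => hYm.comp (measurable_pi_apply i)
  -- the minimizer of the Chernoff exponent `4 t² - ε t`
  set t := ε / 8 with ht
  have hts : |t * s| ≤ 1 / 4 := by
    rw [abs_mul, hs, abs_of_pos (by positivity)]; linarith
  have hts' : t * s < 1 / 2 := by linarith [le_abs_self (t * s)]
  have hind : iIndepFun X (Measure.pi fun _ : Fin m => ν) :=
    iIndepFun_pi (X := fun _ : Fin m => Y) fun _ => hYm.aemeasurable
  have hcomp : (fun g => exp (t * Y g))
      = (fun x : ℝ => exp (t * s * (x ^ 2 - 1))) ∘ fun g => inner ℝ z g := by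
    ext g; simp [hY, mul_assoc]
  have hint : Integrable (fun g => exp (t * Y g)) ν := by
    rw [hcomp]
    refine Integrable.comp_aemeasurable ?_ (by fun_prop)
    rw [map_inner_stdGaussian hz]
    exact integrable_exp_sq_sub_one_gaussianReal hts'
  have hmgf : mgf Y ν t ≤ exp (4 * t ^ 2) := by
    have h1 : mgf Y ν t = ∫ x, exp (t * s * (x ^ 2 - 1)) ∂gaussianReal 0 1 := by
      rw [← map_inner_stdGaussian hz, integral_map (by fun_prop) (by fun_prop)]
      simp [mgf, hY, mul_assoc, ν]
    rw [h1]
    refine (integral_exp_sq_sub_one_gaussianReal_le hts).trans ?_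
    have : s ^ 2 = 1 := by rw [← sq_abs, hs]; norm_num
    rw [mul_pow, this, mul_one]
  have hmgfX : ∀ i, mgf (X i) (Measure.pi fun _ : Fin m => ν) t = mgf Y ν t := fun i =>
    integral_comp_eval (μ := fun _ : Fin m => ν) (f := fun g => exp (t * Y g)) hint.1
  have key := measure_ge_le_exp_mul_mgf (μ := Measure.pi fun _ : Fin m => ν)
    (X := ∑ i, X i) (t := t) (m * ε) (by positivity)
    (hind.integrable_exp_mul_sum hXm fun i _ =>
      integrable_comp_eval (μ := fun _ : Fin m => ν) (i := i) (f := fun g => exp (t * Y g)) hint)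
  rw [hind.mgf_sum hXm, Finset.prod_congr rfl fun i _ => hmgfX i, Finset.prod_const,
    Finset.card_univ, Fintype.card_fin] at key
  simp only [Finset.sum_apply] at key
  refine key.trans ?_
  calc exp (-t * (m * ε)) * mgf Y ν t ^ m
      ≤ exp (-t * (m * ε)) * exp (4 * t ^ 2) ^ m := by gcongr; exact mgf_nonneg
    _ = exp (-(m * ε ^ 2 / 16)) := by
      rw [← exp_nat_mul, ← exp_add]; congr 1; rw [ht]; ring

/-- The matrices with independent centred Gaussian entries of variance `1 / m`. -/
def gaussianMatrix (m d : ℕ) : Measure (Fin m → Fin d → ℝ) :=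
  (Measure.pi fun _ : Fin m => stdGaussian (EuclideanSpace ℝ (Fin d))).map
    fun G i k => (√m)⁻¹ * G i k

lemma measurable_gaussianMatrix_map (m d : ℕ) :
    Measurable fun (G : Fin m → EuclideanSpace ℝ (Fin d)) (i : Fin m) (k : Fin d) =>
      (√m)⁻¹ * G i k := by fun_prop

lemma continuous_project {m d : ℕ} (z : EuclideanSpace ℝ (Fin d)) :
    Continuous fun P : Fin m → Fin d → ℝ => project P z := by
  have : (fun P : Fin m → Fin d → ℝ => project P z)
      = fun P => WithLp.toLp 2 fun i => ∑ k, P i k * z k := by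
    ext P i
    simp [project, Matrix.toLpLin_apply, Matrix.mulVec, dotProduct]
  rw [this]
  fun_prop

lemma norm_project_sq {m d : ℕ} (P : Fin m → Fin d → ℝ) (z : EuclideanSpace ℝ (Fin d)) :
    ‖project P z‖ ^ 2 = ∑ i, (∑ k, P i k * z k) ^ 2 := by
  simp [EuclideanSpace.norm_sq_eq, project, Matrix.toLpLin_apply, Matrix.mulVec, dotProduct]

theorem gaussianMatrix_isDJL {m d : ℕ} {ε δ : ℝ} (hm : 0 < m) (hε : 0 < ε) (hε1 : ε < 1)
    (hδ : 2 * exp (-(m * ε ^ 2 / 16)) < δ) : IsDJL (gaussianMatrix m d) ε δ := by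
  refine ⟨Measure.isProbabilityMeasure_map (measurable_gaussianMatrix_map m d).aemeasurable,
    fun z hz => lt_of_le_of_lt ?_ hδ⟩
  have hmR : (0 : ℝ) < m := by exact_mod_cast hm
  have hcont := continuous_project (m := m) z
  rw [gaussianMatrix, map_measureReal_apply (measurable_gaussianMatrix_map m d)
    (measurableSet_lt measurable_const (by fun_prop))]
  have hnorm : ∀ G : Fin m → EuclideanSpace ℝ (Fin d),
      m * (‖project (fun i k => (√m)⁻¹ * G i k) z‖ ^ 2 - 1)
        = ∑ i, (inner ℝ z (G i) ^ 2 - 1) := by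
    intro G
    have : ∀ i, ∑ k, (√m)⁻¹ * G i k * z k = (√m)⁻¹ * inner ℝ z (G i) := fun i => by
      simp [PiLp.inner_apply, Finset.mul_sum, mul_assoc]
    simp only [norm_project_sq, this, mul_pow, inv_pow, sq_sqrt hmR.le]
    rw [← Finset.mul_sum, Finset.sum_sub_distrib, mul_sub, mul_inv_cancel_left₀ hmR.ne']
    simp
  set μ := Measure.pi fun _ : Fin m => stdGaussian (EuclideanSpace ℝ (Fin d))
  have hsub : (fun (G : Fin m → EuclideanSpace ℝ (Fin d)) i k => (√m)⁻¹ * G i k) ⁻¹'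
      {P | ε < |‖project P z‖ ^ 2 - 1|} ⊆
      {G | m * ε ≤ ∑ i, 1 * (inner ℝ z (G i) ^ 2 - 1)} ∪
      {G | m * ε ≤ ∑ i, (-1) * (inner ℝ z (G i) ^ 2 - 1)} := by
    intro G hG
    have hG' : ε < |‖project (fun i k => (√m)⁻¹ * G i k) z‖ ^ 2 - 1| := hG
    refine (lt_abs.1 hG').imp (fun h => ?_) (fun h => ?_)
    · change m * ε ≤ ∑ i, 1 * (inner ℝ z (G i) ^ 2 - 1)
      rw [← Finset.mul_sum, ← hnorm, one_mul]
      exact mul_le_mul_of_nonneg_left h.le hmR.le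
    · change m * ε ≤ ∑ i, (-1) * (inner ℝ z (G i) ^ 2 - 1)
      rw [← Finset.mul_sum, ← hnorm, neg_one_mul, ← mul_neg]
      exact mul_le_mul_of_nonneg_left h.le hmR.le
  calc _ ≤ _ := measureReal_mono hsub
    _ ≤ _ := measureReal_union_le _ _
    _ ≤ _ := by
      rw [two_mul]
      exact add_le_add (pi_stdGaussian_tail hz hε hε1 (by simp))
        (pi_stdGaussian_tail hz hε hε1 (by simp))

/-- The distributional Johnson–Lindenstrauss lemma. -/
theorem exists_isDJL {n d : ℕ} {p ε : ℝ} (hn : 2 ≤ n) (hp : 2 < p) (hε : 0 < ε) (hε1 : ε < 1) :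
    ∃ m : ℕ, (m : ℝ) ≤ 17 * p * log n / ε ^ 2 ∧
      ∃ D : Measure (Fin m → Fin d → ℝ), IsDJL D ε (2 / (n : ℝ) ^ p) := by
  have hn' : (2 : ℝ) ≤ n := by exact_mod_cast hn
  have hlog : 1 / 2 ≤ log n :=
    (by linarith [log_two_gt_d9] : 1 / 2 ≤ log 2).trans (log_le_log (by norm_num) hn')
  set x := p * log n / ε ^ 2 with hx
  have hx1 : 1 ≤ x := by
    rw [hx, one_le_div (by positivity)]
    nlinarith
  refine ⟨⌊16 * x⌋₊ + 1, ?_, gaussianMatrix _ d, gaussianMatrix_isDJL (by simp) hε hε1 ?_⟩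
  · push_cast
    have := Nat.floor_le (show 0 ≤ 16 * x by linarith)
    calc _ ≤ 17 * x := by linarith
      _ = _ := by rw [hx]; ring
  · have h := Nat.lt_floor_add_one (16 * x)
    rw [rpow_def_of_pos (by linarith), div_eq_mul_inv 2, ← exp_neg]
    refine mul_lt_mul_of_pos_left (exp_lt_exp.2 (neg_lt_neg ?_)) two_pos
    have h2 : x * ε ^ 2 = log n * p := by rw [hx]; field_simp
    push_cast
    have : 0 < ε ^ 2 := by positivity
    nlinarith

end Gaussian

/-! ### The optimal solution of the convex clustering model -/

section Optimum

variable {n d K : ℕ} {b : Fin n → EuclideanSpace ℝ (Fin d)} {w : Fin n → Fin n → ℝ} {γ : ℝ}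

/-- The penalty as a sum over all ordered pairs; the diagonal does not contribute. -/
lemma objective_eq (hw : ∀ i j, w i j = w j i) (x : Fin n → EuclideanSpace ℝ (Fin d)) :
    objective b w γ x
      = (1 / 2) * ∑ i, ‖x i - b i‖ ^ 2 + γ / 2 * ∑ i, ∑ j, w i j * ‖x i - x j‖ := by
  have h1 : ∑ i, ∑ j ∈ Finset.univ.filter (fun j => j < i), w i j * ‖x i - x j‖
      = ∑ i, ∑ j ∈ Finset.univ.filter (fun j => i < j), w i j * ‖x i - x j‖ := by
    simp only [Finset.sum_filter]
    rw [Finset.sum_comm]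
    simp_rw [hw, norm_sub_rev]
  have h2 : ∀ i j, w i j * ‖x i - x j‖ = (if i < j then w i j * ‖x i - x j‖ else 0)
      + if j < i then w i j * ‖x i - x j‖ else 0 := by
    intro i j
    rcases lt_trichotomy i j with h | rfl | h
    · simp [h, h.not_gt]
    · simp
    · simp [h, h.not_gt]
  have h3 : ∑ i, ∑ j, w i j * ‖x i - x j‖
      = 2 * ∑ i, ∑ j ∈ Finset.univ.filter (fun j => i < j), w i j * ‖x i - x j‖ := by
    rw [Finset.sum_congr rfl fun i _ => Finset.sum_congr rfl fun j _ => h2 i j]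
    simp_rw [Finset.sum_add_distrib, ← Finset.sum_filter]
    rw [h1, two_mul]
  rw [objective, h3]
  ring

lemma mul_norm_sub_le (hw0 : ∀ i j, i ≠ j → 0 ≤ w i j) {x : Fin n → EuclideanSpace ℝ (Fin d)}
    {i j : Fin n} {r : ℝ} (hr : i = j → 0 ≤ w i j * r) (h : ‖x i - x j‖ ≤ r) :
    w i j * ‖x i - x j‖ ≤ w i j * r := by
  rcases eq_or_ne i j with rfl | hij
  · simpa using hr rfl
  · exact mul_le_mul_of_nonneg_left h (hw0 i j hij)

/-- Strong convexity of the objective, at midpoints. -/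
lemma objective_midpoint_le (hw : ∀ i j, w i j = w j i) (hw0 : ∀ i j, i ≠ j → 0 ≤ w i j)
    (hγ : 0 ≤ γ) (x y : Fin n → EuclideanSpace ℝ (Fin d)) :
    objective b w γ (fun i => (1 / 2 : ℝ) • (x i + y i)) + (1 / 8) * ∑ i, ‖x i - y i‖ ^ 2
      ≤ (objective b w γ x + objective b w γ y) / 2 := by
  simp only [objective_eq hw]
  have h1 : ∑ i, ‖(1 / 2 : ℝ) • (x i + y i) - b i‖ ^ 2
      = (1 / 2) * ∑ i, ‖x i - b i‖ ^ 2 + (1 / 2) * ∑ i, ‖y i - b i‖ ^ 2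
        - (1 / 4) * ∑ i, ‖x i - y i‖ ^ 2 := by
    rw [Finset.mul_sum, Finset.mul_sum, Finset.mul_sum, ← Finset.sum_add_distrib,
      ← Finset.sum_sub_distrib]
    refine Finset.sum_congr rfl fun i _ => ?_
    have e1 : (1 / 2 : ℝ) • (x i + y i) - b i = (1 / 2 : ℝ) • ((x i - b i) + (y i - b i)) := by
      module
    have e2 : x i - y i = (x i - b i) - (y i - b i) := by abel
    have := parallelogram_law_with_norm ℝ (x i - b i) (y i - b i)
    rw [e1, e2, norm_smul, Real.norm_of_nonneg (by norm_num)]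
    nlinarith
  have h2 : ∑ i, ∑ j, w i j * ‖(1 / 2 : ℝ) • (x i + y i) - (1 / 2 : ℝ) • (x j + y j)‖
      ≤ (1 / 2) * ∑ i, ∑ j, w i j * ‖x i - x j‖ + (1 / 2) * ∑ i, ∑ j, w i j * ‖y i - y j‖ := by
    simp only [Finset.mul_sum, ← Finset.sum_add_distrib]
    refine Finset.sum_le_sum fun i _ => Finset.sum_le_sum fun j _ => ?_
    refine (mul_norm_sub_le (x := fun i => (1 / 2 : ℝ) • (x i + y i)) hw0
      (r := (1 / 2) * ‖x i - x j‖ + (1 / 2) * ‖y i - y j‖) ?_ ?_).trans_eq (by ring)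
    · rintro rfl; simp
    · have e : (1 / 2 : ℝ) • (x i + y i) - (1 / 2 : ℝ) • (x j + y j)
          = (1 / 2 : ℝ) • (x i - x j) + (1 / 2 : ℝ) • (y i - y j) := by module
      change ‖(1 / 2 : ℝ) • (x i + y i) - (1 / 2 : ℝ) • (x j + y j)‖ ≤ _
      rw [e]
      refine (norm_add_le _ _).trans_eq ?_
      rw [norm_smul, norm_smul, Real.norm_of_nonneg (by norm_num)]
  rw [h1]
  nlinarith [mul_le_mul_of_nonneg_left h2 (by positivity : (0 : ℝ) ≤ γ / 2)]

lemma continuous_objective : Continuous (objective b w γ) := by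
  unfold objective
  fun_prop

lemma sum_mul_norm_nonneg (hw0 : ∀ i j, i ≠ j → 0 ≤ w i j)
    (x : Fin n → EuclideanSpace ℝ (Fin d)) : 0 ≤ ∑ i, ∑ j, w i j * ‖x i - x j‖ := by
  refine Finset.sum_nonneg fun i _ => Finset.sum_nonneg fun j _ => ?_
  rcases eq_or_ne i j with rfl | hij
  · simp
  · exact mul_nonneg (hw0 i j hij) (norm_nonneg _)

theorem exists_isMinOn_objective (hw : ∀ i j, w i j = w j i) (hw0 : ∀ i j, i ≠ j → 0 ≤ w i j)
    (hγ : 0 ≤ γ) : ∃ x, IsMinOn (objective b w γ) Set.univ x := by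
  have hlow : ∀ x, (1 / 2) * ∑ i, ‖x i - b i‖ ^ 2 ≤ objective b w γ x := fun x => by
    rw [objective_eq hw]
    have := mul_nonneg (by positivity : (0 : ℝ) ≤ γ / 2) (sum_mul_norm_nonneg hw0 x)
    linarith
  set M := objective b w γ b with hM
  -- outside of this ball the quadratic term alone exceeds the value at `b`
  set R := 2 * |M| + 1 with hR
  have hout : ∀ x, x ∉ Metric.closedBall b R → objective b w γ b ≤ objective b w γ x := by
    intro x hx
    refine le_trans ?_ (hlow x)
    have hR0 : 0 ≤ R := by positivity
    rw [Metric.mem_closedBall, dist_pi_le_iff hR0] at hx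
    push Not at hx
    obtain ⟨i, hi⟩ := hx
    rw [dist_eq_norm] at hi
    have h1 : ‖x i - b i‖ ^ 2 ≤ ∑ i, ‖x i - b i‖ ^ 2 :=
      Finset.single_le_sum (f := fun i => ‖x i - b i‖ ^ 2) (fun _ _ => sq_nonneg _)
        (Finset.mem_univ i)
    have h2 : R * 1 ≤ ‖x i - b i‖ ^ 2 := by
      have : 1 ≤ R := by rw [hR]; linarith [abs_nonneg M]
      nlinarith
    rw [← hM]
    linarith [le_abs_self M]
  obtain ⟨x, -, hx⟩ := (isCompact_closedBall b R).exists_isMinOn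
    ⟨b, Metric.mem_closedBall_self (by positivity)⟩
    (continuous_objective (b := b) (w := w) (γ := γ)).continuousOn
  refine ⟨x, fun y _ => ?_⟩
  by_cases hy : y ∈ Metric.closedBall b R
  · exact hx hy
  · exact (hx (Metric.mem_closedBall_self (by positivity))).trans (hout y hy)

theorem eq_of_isMinOn_objective (hw : ∀ i j, w i j = w j i) (hw0 : ∀ i j, i ≠ j → 0 ≤ w i j)
    (hγ : 0 ≤ γ) {x y : Fin n → EuclideanSpace ℝ (Fin d)}
    (hx : IsMinOn (objective b w γ) Set.univ x) (hy : IsMinOn (objective b w γ) Set.univ y) :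
    x = y := by
  have h := objective_midpoint_le (b := b) hw hw0 hγ x y
  have h1 := hx (Set.mem_univ fun i => (1 / 2 : ℝ) • (x i + y i))
  have h2 := hy (Set.mem_univ fun i => (1 / 2 : ℝ) • (x i + y i))
  simp only [Set.mem_ofPred_eq] at h1 h2
  have h3 : ∑ i, ‖x i - y i‖ ^ 2 = 0 :=
    le_antisymm (by linarith) (Finset.sum_nonneg fun _ _ => sq_nonneg _)
  rw [Finset.sum_eq_zero_iff_of_nonneg fun _ _ => sq_nonneg _] at h3
  ext1 i
  simpa [sub_eq_zero] using h3 i (Finset.mem_univ i)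

theorem isOptimalSolution_of_isMinOn (hw : ∀ i j, w i j = w j i) (hw0 : ∀ i j, i ≠ j → 0 ≤ w i j)
    (hγ : 0 ≤ γ) {x : Fin n → EuclideanSpace ℝ (Fin d)}
    (hx : IsMinOn (objective b w γ) Set.univ x) : IsOptimalSolution b w γ x :=
  fun _ => ⟨fun hy => eq_of_isMinOn_objective hw hw0 hγ hy hx, fun h => h ▸ hx⟩

/-- First-order optimality: the one-sided derivative of the objective at a minimizer, in any
direction `h`, is nonnegative. The derivative of each term `‖x i - x j‖` is at most `‖h i - h j‖`,
which suffices where it is used. -/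
lemma isMinOn_objective_first_order (hw : ∀ i j, w i j = w j i)
    (hw0 : ∀ i j, i ≠ j → 0 ≤ w i j) (hγ : 0 ≤ γ) {x : Fin n → EuclideanSpace ℝ (Fin d)}
    (hx : IsMinOn (objective b w γ) Set.univ x) (h : Fin n → EuclideanSpace ℝ (Fin d)) :
    0 ≤ ∑ i, inner ℝ (x i - b i) (h i) + γ / 2 * ∑ i, ∑ j, w i j * ‖h i - h j‖ := by
  set A := ∑ i, inner ℝ (x i - b i) (h i) + γ / 2 * ∑ i, ∑ j, w i j * ‖h i - h j‖ with hA
  have hγ2 : 0 ≤ γ / 2 := by positivity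
  have key : ∀ t : ℝ, 0 < t → 0 ≤ A + t * ((1 / 2) * ∑ i, ‖h i‖ ^ 2) := by
    intro t ht
    have hmin := hx (Set.mem_univ fun i => x i + t • h i)
    simp only [Set.mem_ofPred_eq, objective_eq hw] at hmin
    have h1 : ∑ i, ‖x i + t • h i - b i‖ ^ 2 = ∑ i, ‖x i - b i‖ ^ 2
        + 2 * t * ∑ i, inner ℝ (x i - b i) (h i) + t ^ 2 * ∑ i, ‖h i‖ ^ 2 := by
      rw [Finset.mul_sum, Finset.mul_sum, ← Finset.sum_add_distrib, ← Finset.sum_add_distrib]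
      refine Finset.sum_congr rfl fun i _ => ?_
      rw [show x i + t • h i - b i = (x i - b i) + t • h i by abel, norm_add_sq_real,
        inner_smul_right, norm_smul, mul_pow, Real.norm_eq_abs, sq_abs]
      ring
    have h2 : ∑ i, ∑ j, w i j * ‖x i + t • h i - (x j + t • h j)‖
        ≤ ∑ i, ∑ j, w i j * ‖x i - x j‖ + t * ∑ i, ∑ j, w i j * ‖h i - h j‖ := by
      simp only [Finset.mul_sum, ← Finset.sum_add_distrib]
      refine Finset.sum_le_sum fun i _ => Finset.sum_le_sum fun j _ => ?_
      refine (mul_norm_sub_le (x := fun i => x i + t • h i) hw0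
        (r := ‖x i - x j‖ + t * ‖h i - h j‖) ?_ ?_).trans_eq (by ring)
      · rintro rfl; simp
      · rw [show x i + t • h i - (x j + t • h j) = (x i - x j) + t • (h i - h j) by module]
        refine (norm_add_le _ _).trans_eq ?_
        rw [norm_smul, Real.norm_of_nonneg ht.le]
    have h3 := mul_le_mul_of_nonneg_left h2 hγ2
    rw [h1] at hmin
    have h4 : 0 ≤ t * (A + t * ((1 / 2) * ∑ i, ‖h i‖ ^ 2)) := by
      rw [hA]; nlinarith
    exact nonneg_of_mul_nonneg_right h4 ht
  have hlim : Filter.Tendsto (fun t : ℝ => A + t * ((1 / 2) * ∑ i, ‖h i‖ ^ 2))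
      (nhdsWithin 0 (Set.Ioi 0)) (nhds A) := by
    have : Filter.Tendsto (fun t : ℝ => A + t * ((1 / 2) * ∑ i, ‖h i‖ ^ 2)) (nhds 0)
        (nhds (A + 0 * ((1 / 2) * ∑ i, ‖h i‖ ^ 2))) := Continuous.tendsto (by fun_prop) 0
    rw [zero_mul, add_zero] at this
    exact this.mono_left nhdsWithin_le_nhds
  exact ge_of_tendsto hlim (by filter_upwards [self_mem_nhdsWithin] with t ht using key t ht)

end Optimum

/-! ### Solutions that are constant on the clusters -/

section Recovery

variable {n d K : ℕ} {b : Fin n → EuclideanSpace ℝ (Fin d)} {c : Fin n → Fin K}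
  {w : Fin n → Fin n → ℝ} {γ : ℝ}

@[simp]
lemma mem_idx {i : Fin n} {α : Fin K} : i ∈ idx c α ↔ c i = α := by simp [idx]

lemma sum_idx {M : Type*} [AddCommMonoid M] (f : Fin n → M) (s : Finset (Fin K)) :
    ∑ β ∈ s, ∑ j ∈ idx c β, f j = ∑ j ∈ Finset.univ.filter (fun j => c j ∈ s), f j := by
  rw [← Finset.sum_fiberwise_of_maps_to (s := Finset.univ.filter fun j => c j ∈ s) (t := s)
    (g := c) (by simp)]
  refine Finset.sum_congr rfl fun β hβ => Finset.sum_congr ?_ fun _ _ => rfl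
  ext j
  simp only [mem_idx, Finset.mem_filter, Finset.mem_univ, true_and]
  exact ⟨fun h => ⟨h ▸ hβ, h⟩, And.right⟩

lemma card_idx_pos (i : Fin n) : (0 : ℝ) < (idx c (c i)).card :=
  Nat.cast_pos.2 (Finset.card_pos.2 ⟨i, by simp⟩)

lemma card_idx_smul_centroid (x : Fin n → EuclideanSpace ℝ (Fin d)) {α : Fin K}
    (hα : (idx c α).Nonempty) : ((idx c α).card : ℝ) • centroid x c α = ∑ i ∈ idx c α, x i := by
  rw [centroid, smul_inv_smul₀ (Nat.cast_ne_zero.2 hα.card_ne_zero)]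

/-- The deviations from the centroid of a cluster add up to zero. -/
lemma sum_idx_sub_centroid (x : Fin n → EuclideanSpace ℝ (Fin d)) (α : Fin K) :
    ∑ i ∈ idx c α, (x i - centroid x c (c i)) = 0 := by
  rcases (idx c α).eq_empty_or_nonempty with h | h
  · simp [h]
  · rw [Finset.sum_congr rfl (g := fun i => x i - centroid x c α)
      fun i hi => by rw [mem_idx.1 hi], Finset.sum_sub_distrib, Finset.sum_const,
      ← Nat.cast_smul_eq_nsmul ℝ, card_idx_smul_centroid x h, sub_self]

/-- A function that depends on the cluster only is orthogonal to the deviations from the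
centroids. -/
lemma sum_inner_sub_centroid (x : Fin n → EuclideanSpace ℝ (Fin d))
    (f : Fin K → EuclideanSpace ℝ (Fin d)) :
    ∑ i, inner ℝ (f (c i)) (x i - centroid x c (c i)) = 0 := by
  rw [← Finset.sum_fiberwise (s := Finset.univ) (g := c)]
  refine Finset.sum_eq_zero fun α _ => ?_
  change ∑ i ∈ idx c α, _ = _
  rw [Finset.sum_congr rfl (g := fun i => inner ℝ (f α) (x i - centroid x c (c i)))
    fun i hi => by rw [mem_idx.1 hi], ← inner_sum, sum_idx_sub_centroid, inner_zero_right]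

/-- Replacing every point by the centroid of its cluster does not increase the objective, if the
weights inside the clusters are large enough in comparison with the diameters.

Write `x = X + u`, where `X` is constant on the clusters and `u` has zero cluster sums. The
penalties between different clusters are bounded below by their linearization at `X`. With the
linear term of the quadratic part, they amount to `- ∑ i, ⟪s i, u i⟫` for a certain vector `s`,
which is `- (1 / n_α) ∑ ⟪s i - s j, u i - u j⟫` summed over the pairs inside the clusters,
since the cluster sums of `u` are zero. The hypothesis says that `‖s i - s j‖ ≤ γ n_α w i j`, so
that this is compensated by the penalties inside the clusters. -/
theorem objective_centroid_le (hw : ∀ i j, w i j = w j i) (hw0 : ∀ i j, i ≠ j → 0 ≤ w i j)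
    (hγ : 0 ≤ γ)
    (hdiam : ∀ i j, c i = c j → i ≠ j →
      ‖b i - b j‖ ≤ γ * ((idx c (c i)).card * w i j - mu w c (c i) i j))
    (x : Fin n → EuclideanSpace ℝ (Fin d)) :
    objective b w γ (fun i => centroid x c (c i)) ≤ objective b w γ x := by
  set y := centroid x c with hy
  set u : Fin n → EuclideanSpace ℝ (Fin d) := fun i => x i - y (c i) with hu
  -- the direction of `y α - y β`, or zero
  set Z : Fin K → Fin K → EuclideanSpace ℝ (Fin d) :=
    fun α β => ‖y α - y β‖⁻¹ • (y α - y β) with hZ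
  have hZself : ∀ α, Z α α = 0 := fun α => by simp [hZ]
  have hZneg : ∀ α β, Z β α = -Z α β := fun α β => by
    simp only [hZ]; rw [norm_sub_rev, ← smul_neg, neg_sub]
  have hZle : ∀ α β, ‖Z α β‖ ≤ 1 := fun α β => by
    simp only [hZ, norm_smul, norm_inv, norm_norm]
    exact inv_mul_le_one
  have hZinner : ∀ α β, inner ℝ (Z α β) (y α - y β) = ‖y α - y β‖ := fun α β => by
    simp only [hZ]
    rw [real_inner_smul_left, real_inner_self_eq_norm_sq]
    rcases eq_or_ne ‖y α - y β‖ 0 with h | h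
    · simp [h]
    · field_simp
  set s : Fin n → EuclideanSpace ℝ (Fin d) :=
    fun i => b i - γ • ∑ k, w i k • Z (c i) (c k) with hs
  have hsdiff : ∀ i j, c i = c j → i ≠ j →
      ‖s i - s j‖ ≤ γ * ((idx c (c i)).card * w i j) := by
    intro i j hij hne
    have h1 : s i - s j = (b i - b j)
        - γ • ∑ β ∈ Finset.univ.erase (c i), (wPoint w c i β - wPoint w c j β) • Z (c i) β := by
      have h2 : ∀ i' : Fin n, ∑ k, w i' k • Z (c i) (c k)
          = ∑ β ∈ Finset.univ.erase (c i), wPoint w c i' β • Z (c i) β := by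
        intro i'
        rw [← Finset.sum_fiberwise (s := Finset.univ) (g := c), eq_comm]
        refine (Finset.sum_subset (Finset.subset_univ _) ?_).trans ?_
        · intro β _ hβ
          have : β = c i := by simpa using hβ
          rw [this, hZself, smul_zero]
        · refine Finset.sum_congr rfl fun β _ => ?_
          rw [wPoint, Finset.sum_smul]
          exact Finset.sum_congr rfl fun k hk => by rw [mem_idx.1 hk]
      simp only [hs, ← hij, h2, sub_smul, Finset.sum_sub_distrib]
      module
    have h3 : ‖∑ β ∈ Finset.univ.erase (c i), (wPoint w c i β - wPoint w c j β) • Z (c i) β‖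
        ≤ mu w c (c i) i j := by
      refine norm_sum_le_of_le _ fun β _ => ?_
      rw [norm_smul, Real.norm_eq_abs]
      exact mul_le_of_le_one_right (abs_nonneg _) (hZle _ _)
    have h4 := mul_le_mul_of_nonneg_left h3 hγ
    rw [h1]
    refine (norm_sub_le _ _).trans ?_
    rw [norm_smul, Real.norm_of_nonneg hγ]
    have := hdiam i j hij hne
    linarith
  -- lower bound for the penalty of each pair
  have hpair : ∀ i j, γ * (w i j * ‖y (c i) - y (c j)‖)
        + γ * (w i j * inner ℝ (Z (c i) (c j)) (u i - u j))
        + (if c j = c i then ((idx c (c i)).card : ℝ)⁻¹ * inner ℝ (s i - s j) (u i - u j) else 0)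
      ≤ γ * (w i j * ‖x i - x j‖) := by
    intro i j
    rcases eq_or_ne i j with rfl | hne
    · simp
    by_cases hij : c j = c i
    · have h1 : x i - x j = u i - u j := by simp [hu, hij]
      have hcard := card_idx_pos (c := c) i
      rw [if_pos hij, hij, hZself, sub_self, norm_zero, inner_zero_left, h1]
      simp only [mul_zero, zero_add]
      rw [inv_mul_le_iff₀ hcard]
      refine (real_inner_le_norm _ _).trans ?_
      refine (mul_le_mul_of_nonneg_right (hsdiff i j hij.symm hne) (norm_nonneg _)).trans_eq ?_
      ring
    · rw [if_neg hij, add_zero, ← mul_add, ← mul_add]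
      refine mul_le_mul_of_nonneg_left (mul_le_mul_of_nonneg_left ?_ (hw0 i j hne)) hγ
      rw [← hZinner, ← inner_add_right,
        show y (c i) - y (c j) + (u i - u j) = x i - x j by simp only [hu]; abel]
      refine (real_inner_le_norm _ _).trans ?_
      exact mul_le_of_le_one_left (norm_nonneg _) (hZle _ _)
  have hsum := Finset.sum_le_sum fun i (_ : i ∈ Finset.univ) =>
    Finset.sum_le_sum fun j (_ : j ∈ Finset.univ) => hpair i j
  simp only [Finset.sum_add_distrib, ← Finset.mul_sum] at hsum
  have hcross : ∑ i, ∑ j, w i j * inner ℝ (Z (c i) (c j)) (u i - u j)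
      = 2 * ∑ i, inner ℝ (∑ k, w i k • Z (c i) (c k)) (u i) := by
    have h1 : ∑ i, ∑ j, w i j * inner ℝ (Z (c i) (c j)) (u j)
        = -∑ i, ∑ j, w i j * inner ℝ (Z (c i) (c j)) (u i) := by
      rw [Finset.sum_comm, ← Finset.sum_neg_distrib]
      refine Finset.sum_congr rfl fun i _ => ?_
      rw [← Finset.sum_neg_distrib]
      refine Finset.sum_congr rfl fun j _ => ?_
      rw [hZneg, hw, inner_neg_left, mul_neg]
    simp only [inner_sub_right, mul_sub, Finset.sum_sub_distrib, h1, sum_inner,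
      real_inner_smul_left]
    ring
  have hwithin : ∑ i, ∑ j,
      (if c j = c i then ((idx c (c i)).card : ℝ)⁻¹ * inner ℝ (s i - s j) (u i - u j) else 0)
      = 2 * ∑ i, inner ℝ (s i) (u i) := by
    have hrow : ∀ i, ∑ j, (if c j = c i then
        ((idx c (c i)).card : ℝ)⁻¹ * inner ℝ (s i) (u i - u j) else 0)
        = inner ℝ (s i) (u i) := by
      intro i
      rw [← Finset.sum_filter]
      change ∑ j ∈ idx c (c i), _ = _
      rw [← Finset.mul_sum, ← inner_sum, Finset.sum_sub_distrib, sum_idx_sub_centroid, sub_zero,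
        Finset.sum_const, ← Nat.cast_smul_eq_nsmul ℝ, real_inner_smul_right,
        inv_mul_cancel_left₀ (card_idx_pos i).ne']
    have hcol : ∑ i, ∑ j, (if c j = c i then
        ((idx c (c i)).card : ℝ)⁻¹ * inner ℝ (s j) (u i - u j) else 0)
        = -∑ i, inner ℝ (s i) (u i) := by
      rw [Finset.sum_comm, ← Finset.sum_neg_distrib]
      refine Finset.sum_congr rfl fun i _ => ?_
      rw [← hrow i, ← Finset.sum_neg_distrib]
      refine Finset.sum_congr rfl fun j _ => ?_
      by_cases h : c j = c i
      · rw [if_pos h, if_pos h.symm, h, ← mul_neg, ← inner_neg_right, neg_sub]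
      · rw [if_neg h, if_neg (Ne.symm h), neg_zero]
    have hsplit : ∀ i j : Fin n, (if c j = c i then
        ((idx c (c i)).card : ℝ)⁻¹ * inner ℝ (s i - s j) (u i - u j) else 0)
        = (if c j = c i then ((idx c (c i)).card : ℝ)⁻¹ * inner ℝ (s i) (u i - u j) else 0)
        - (if c j = c i then ((idx c (c i)).card : ℝ)⁻¹ * inner ℝ (s j) (u i - u j) else 0) := by
      intro i j
      split_ifs
      · rw [inner_sub_left, mul_sub]
      · simp
    simp only [hsplit, Finset.sum_sub_distrib, hcol, hrow]
    ring
  have hquad : ∑ i, ‖x i - b i‖ ^ 2 = ∑ i, ‖y (c i) - b i‖ ^ 2 + ∑ i, ‖u i‖ ^ 2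
      - 2 * ∑ i, inner ℝ (b i) (u i) := by
    have h0 : ∑ i, inner ℝ (y (c i)) (u i) = 0 := sum_inner_sub_centroid x y
    have h1 : ∀ i, ‖x i - b i‖ ^ 2 = ‖y (c i) - b i‖ ^ 2 + ‖u i‖ ^ 2
        - 2 * inner ℝ (b i) (u i) + 2 * inner ℝ (y (c i)) (u i) := by
      intro i
      rw [show x i - b i = (y (c i) - b i) + u i by simp only [hu]; abel, norm_add_sq_real,
        inner_sub_left]
      ring
    simp only [h1, Finset.sum_add_distrib, Finset.sum_sub_distrib, ← Finset.mul_sum, h0]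
    ring
  have hlin : γ * ∑ i, inner ℝ (∑ k, w i k • Z (c i) (c k)) (u i) + ∑ i, inner ℝ (s i) (u i)
      = ∑ i, inner ℝ (b i) (u i) := by
    rw [Finset.mul_sum, ← Finset.sum_add_distrib]
    refine Finset.sum_congr rfl fun i _ => ?_
    simp only [hs]
    rw [inner_sub_left, real_inner_smul_left]
    ring
  rw [hcross, hwithin] at hsum
  have hu0 : 0 ≤ ∑ i, ‖u i‖ ^ 2 := Finset.sum_nonneg fun _ _ => sq_nonneg _
  rw [objective_eq hw, objective_eq hw, hquad]
  linarith

lemma wBar_nonneg (hw0 : ∀ i j, i ≠ j → 0 ≤ w i j) (β : Fin K) : 0 ≤ wBar w c β := by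
  refine mul_nonneg (by positivity) ?_
  refine Finset.sum_nonneg fun l hl => Finset.sum_nonneg fun i hi => Finset.sum_nonneg
    fun j hj => hw0 i j ?_
  rintro rfl
  exact Finset.ne_of_mem_erase hl ((mem_idx.1 hj).symm.trans (mem_idx.1 hi))

/-- A minimizer that is constant on the clusters is close to the centroids of the data. -/
theorem norm_sub_centroid_le (hw : ∀ i j, w i j = w j i) (hw0 : ∀ i j, i ≠ j → 0 ≤ w i j)
    (hγ : 0 ≤ γ) {y : Fin K → EuclideanSpace ℝ (Fin d)}
    (hy : IsMinOn (objective b w γ) Set.univ (fun i => y (c i))) {α : Fin K}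
    (hα : (idx c α).Nonempty) : ‖y α - centroid b c α‖ ≤ γ * wBar w c α := by
  set v := centroid b c α - y α with hv
  have hcard : (0 : ℝ) < (idx c α).card := Nat.cast_pos.2 hα.card_pos
  -- only the points of the cluster `α` move, all of them in the direction `v`
  have h := isMinOn_objective_first_order hw hw0 hγ hy (fun i => if c i = α then v else 0)
  have h1 : ∑ i, inner ℝ (y (c i) - b i) (if c i = α then v else 0)
      = -((idx c α).card * ‖v‖ ^ 2) := by
    have e : ∀ i, inner ℝ (y (c i) - b i) (if c i = α then v else 0)
        = if c i = α then inner ℝ (y α - b i) v else 0 := by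
      intro i; split_ifs with h
      · rw [h]
      · simp
    simp only [e]
    rw [← Finset.sum_filter]
    change ∑ i ∈ idx c α, _ = _
    rw [← sum_inner, Finset.sum_sub_distrib, ← card_idx_smul_centroid b hα, Finset.sum_const,
      ← Nat.cast_smul_eq_nsmul ℝ, ← smul_sub, ← neg_sub, ← hv, real_inner_smul_left,
      inner_neg_left, real_inner_self_eq_norm_sq, mul_neg]
  have h2 : ∑ i, ∑ j, w i j * ‖(if c i = α then v else 0) - (if c j = α then v else 0)‖
      = 2 * (((idx c α).card * wBar w c α) * ‖v‖) := by
    have e : ∀ i j, w i j * ‖(if c i = α then v else 0) - (if c j = α then v else 0)‖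
        = (if c i = α then (if c j ≠ α then w i j * ‖v‖ else 0) else 0)
          + (if c j = α then (if c i ≠ α then w j i * ‖v‖ else 0) else 0) := by
      intro i j
      by_cases hi : c i = α <;> by_cases hj : c j = α <;> simp [hi, hj, hw i j]
    have e2 : ∑ i, ∑ j, (if c i = α then (if c j ≠ α then w i j * ‖v‖ else 0) else 0)
        = ((idx c α).card * wBar w c α) * ‖v‖ := by
      rw [wBar, mul_inv_cancel_left₀ hcard.ne']
      simp only [wPair]
      rw [Finset.sum_comm (s := Finset.univ.erase α)]
      simp only [sum_idx, Finset.sum_mul]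
      rw [idx, Finset.sum_filter]
      refine Finset.sum_congr rfl fun i _ => ?_
      split_ifs with hi
      · rw [Finset.sum_filter]
        simp
      · simp
    simp only [e, Finset.sum_add_distrib]
    rw [e2, Finset.sum_comm, e2, two_mul]
  rw [h1, h2] at h
  have h3 : ‖v‖ ^ 2 ≤ γ * wBar w c α * ‖v‖ := by
    refine le_of_mul_le_mul_left ?_ hcard
    linarith
  rw [norm_sub_rev, ← hv]
  rcases eq_or_ne ‖v‖ 0 with h0 | h0
  · rw [h0]
    exact mul_nonneg hγ (wBar_nonneg hw0 α)
  · exact le_of_mul_le_mul_right (by rwa [← sq]) ((norm_nonneg _).lt_of_ne' h0)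

/-- A constant minimizer is the overall mean of the data. -/
lemma eq_mean_of_isMinOn_const (hn : 0 < n) (hw : ∀ i j, w i j = w j i)
    (hw0 : ∀ i j, i ≠ j → 0 ≤ w i j) (hγ : 0 ≤ γ) {q : EuclideanSpace ℝ (Fin d)}
    (hq : IsMinOn (objective b w γ) Set.univ (fun _ => q)) : q = mean b := by
  have hn' : (0 : ℝ) < n := Nat.cast_pos.2 hn
  have h := isMinOn_objective_first_order hw hw0 hγ hq (fun _ => mean b - q)
  have hmean : ∑ i, b i = (n : ℝ) • mean b := by rw [mean, smul_inv_smul₀ hn'.ne']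
  rw [← sum_inner, Finset.sum_sub_distrib, hmean, Finset.sum_const, Finset.card_univ,
    Fintype.card_fin, ← Nat.cast_smul_eq_nsmul ℝ, ← smul_sub, ← neg_sub (mean b) q,
    real_inner_smul_left, inner_neg_left, real_inner_self_eq_norm_sq] at h
  simp only [sub_self, norm_zero, mul_zero, Finset.sum_const_zero, add_zero] at h
  have h2 : ‖mean b - q‖ ^ 2 ≤ 0 := by
    refine le_of_mul_le_mul_left ?_ hn'
    linarith
  have h3 : ‖mean b - q‖ = 0 := by simpa using le_antisymm h2 (sq_nonneg _)
  exact (sub_eq_zero.1 (norm_eq_zero.1 h3)).symm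

theorem exists_isMinOn_const_on_clusters (hw : ∀ i j, w i j = w j i)
    (hw0 : ∀ i j, i ≠ j → 0 ≤ w i j) (hγ : 0 ≤ γ)
    (hdiam : ∀ i j, c i = c j → i ≠ j →
      ‖b i - b j‖ ≤ γ * ((idx c (c i)).card * w i j - mu w c (c i) i j)) :
    ∃ y : Fin K → EuclideanSpace ℝ (Fin d),
      IsMinOn (objective b w γ) Set.univ (fun i => y (c i)) := by
  obtain ⟨x, hx⟩ := exists_isMinOn_objective (b := b) hw hw0 hγ
  exact ⟨centroid x c, fun z hz =>
    (objective_centroid_le hw hw0 hγ hdiam x).trans (hx hz)⟩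

/-- The optimal values of two clusters lie in the balls of radii `γ w̄^(α)` and `γ w̄^(β)` about
the centroids, which are disjoint by `hsep`. -/
theorem exists_perfectlyRecovers (hw : ∀ i j, w i j = w j i)
    (hw0 : ∀ i j, i ≠ j → 0 ≤ w i j) (hγ : 0 ≤ γ)
    (hdiam : ∀ i j, c i = c j → i ≠ j →
      ‖b i - b j‖ ≤ γ * ((idx c (c i)).card * w i j - mu w c (c i) i j))
    (hsep : ∀ α β, α ≠ β →
      γ * (wBar w c α + wBar w c β) < ‖centroid b c α - centroid b c β‖) :
    ∃ x, IsOptimalSolution b w γ x ∧ PerfectlyRecovers x c := by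
  obtain ⟨y, hy⟩ := exists_isMinOn_const_on_clusters hw hw0 hγ hdiam
  refine ⟨_, isOptimalSolution_of_isMinOn hw hw0 hγ hy, fun i j => ⟨fun h => ?_, fun h => ?_⟩⟩
  · by_contra hij
    have h1 := norm_sub_centroid_le hw hw0 hγ hy (α := c i) ⟨i, by simp⟩
    have h2 := norm_sub_centroid_le hw hw0 hγ hy (α := c j) ⟨j, by simp⟩
    rw [h, norm_sub_rev] at h1
    have h3 := norm_sub_le_norm_sub_add_norm_sub (centroid b c (c i)) (y (c j))
      (centroid b c (c j))
    linarith [hsep _ _ hij]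
  · simp only [h]

/-- If all points had the same optimal value, it would be the overall mean, which by `hsep` is too
far from one of the centroids. -/
theorem exists_recoversNontrivialCoarsening (hc : Function.Surjective c)
    (hw : ∀ i j, w i j = w j i) (hw0 : ∀ i j, i ≠ j → 0 ≤ w i j) (hγ : 0 ≤ γ)
    (hdiam : ∀ i j, c i = c j → i ≠ j →
      ‖b i - b j‖ ≤ γ * ((idx c (c i)).card * w i j - mu w c (c i) i j))
    (hsep : ∃ α, γ * wBar w c α < ‖mean b - centroid b c α‖) :
    ∃ x, IsOptimalSolution b w γ x ∧ RecoversNontrivialCoarsening x c := by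
  obtain ⟨y, hy⟩ := exists_isMinOn_const_on_clusters hw hw0 hγ hdiam
  refine ⟨_, isOptimalSolution_of_isMinOn hw hw0 hγ hy, ?_⟩
  obtain ⟨α, hα⟩ := hsep
  obtain ⟨i₀, hi₀⟩ := hc α
  obtain ⟨β, hβ⟩ : ∃ β, y β ≠ y α := by
    by_contra! hall
    rw [show (fun i => y (c i)) = fun _ => y α from funext fun i => hall _] at hy
    have h1 := eq_mean_of_isMinOn_const (Fin.pos i₀) hw hw0 hγ hy
    have h2 := norm_sub_centroid_le (y := fun _ => y α) hw hw0 hγ hy (α := α) ⟨i₀, by simpa⟩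
    rw [h1] at h2
    linarith
  have : Nontrivial (Set.range y) :=
    ⟨⟨⟨y β, β, rfl⟩, ⟨y α, α, rfl⟩, fun h => hβ (congrArg Subtype.val h)⟩⟩
  -- the groups are the fibres of `y`
  let e : Set.range y ≃ Fin (Nat.card (Set.range y)) := Finite.equivFin _
  refine ⟨Nat.card (Set.range y), Finite.one_lt_card, e ∘ Set.rangeFactorization y,
    e.surjective.comp Set.rangeFactorization_surjective, fun i j => ?_⟩
  simp only [Function.comp_apply, e.apply_eq_iff_eq, Set.rangeFactorization, Subtype.mk.injEq]

end Recovery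

/-! ### Recovery from approximately isometric projections -/

section Projection

variable {m n d K : ℕ} {a : Fin n → EuclideanSpace ℝ (Fin d)} {c : Fin n → Fin K}
  {w : Fin n → Fin n → ℝ} {γ ε : ℝ}

lemma project_sub (P : Fin m → Fin d → ℝ) (x y : EuclideanSpace ℝ (Fin d)) :
    project P (x - y) = project P x - project P y := map_sub _ x y

lemma project_smul (P : Fin m → Fin d → ℝ) (t : ℝ) (x : EuclideanSpace ℝ (Fin d)) :
    project P (t • x) = t • project P x := map_smul _ t x

lemma centroid_project (P : Fin m → Fin d → ℝ) (α : Fin K) :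
    centroid (fun i => project P (a i)) c α = project P (centroid a c α) := by
  simp only [centroid, project, map_smul, map_sum]

lemma mean_project (P : Fin m → Fin d → ℝ) :
    mean (fun i => project P (a i)) = project P (mean a) := by
  simp only [mean, project, map_smul, map_sum]

/-- `P` preserves the squared length of `z` up to a relative error of `ε`. -/
def NearlyPreserves (ε : ℝ) (P : Fin m → Fin d → ℝ) (z : EuclideanSpace ℝ (Fin d)) : Prop :=
  |‖project P z‖ ^ 2 - ‖z‖ ^ 2| ≤ ε * ‖z‖ ^ 2

lemma NearlyPreserves.sub_comm {P : Fin m → Fin d → ℝ} {x y : EuclideanSpace ℝ (Fin d)}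
    (h : NearlyPreserves ε P (x - y)) : NearlyPreserves ε P (y - x) := by
  unfold NearlyPreserves at h ⊢
  rwa [project_sub, norm_sub_rev, norm_sub_rev y, ← project_sub]

lemma NearlyPreserves.norm_project_le {P : Fin m → Fin d → ℝ} {z : EuclideanSpace ℝ (Fin d)}
    (h : NearlyPreserves ε P z) : ‖project P z‖ ≤ √(1 + ε) * ‖z‖ := by
  have h1 := (abs_le.1 h).2
  have h2 := Real.sqrt_le_sqrt (show ‖project P z‖ ^ 2 ≤ (1 + ε) * ‖z‖ ^ 2 by linarith)
  rwa [Real.sqrt_mul' _ (sq_nonneg _), Real.sqrt_sq (norm_nonneg _),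
    Real.sqrt_sq (norm_nonneg _)] at h2

lemma NearlyPreserves.le_norm_project {P : Fin m → Fin d → ℝ} {z : EuclideanSpace ℝ (Fin d)}
    (h : NearlyPreserves ε P z) : √(1 - ε) * ‖z‖ ≤ ‖project P z‖ := by
  have h1 := (abs_le.1 h).1
  have h2 := Real.sqrt_le_sqrt (show (1 - ε) * ‖z‖ ^ 2 ≤ ‖project P z‖ ^ 2 by linarith)
  rwa [Real.sqrt_mul' _ (sq_nonneg _), Real.sqrt_sq (norm_nonneg _),
    Real.sqrt_sq (norm_nonneg _)] at h2

lemma mul_norm_sub_le_of_gammaMin_le {s : ℝ} (hs : 0 ≤ s) (hγ : 0 ≤ γ)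
    (h : ENNReal.ofReal s * gammaMin a w c ≤ ENNReal.ofReal γ) {i j : Fin n} (hij : c i = c j)
    (hpos : mu w c (c i) i j < (idx c (c i)).card * w i j) :
    s * ‖a i - a j‖ ≤ γ * ((idx c (c i)).card * w i j - mu w c (c i) i j) := by
  have hpos' := sub_pos.2 hpos
  set B := (idx c (c i)).card * w i j - mu w c (c i) i j with hB
  have h1 : ENNReal.ofReal ‖a i - a j‖ / ENNReal.ofReal B ≤ gammaMin a w c :=
    le_iSup_of_le (c i) <| le_iSup₂_of_le i (by simp) <|
      le_iSup₂_of_le j (by simp [hij]) le_rfl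
  have h2 := (mul_le_mul_right h1 (ENNReal.ofReal s)).trans h
  rw [← ENNReal.ofReal_div_of_pos hpos', ← ENNReal.ofReal_mul hs,
    ENNReal.ofReal_le_ofReal_iff hγ, ← mul_div_assoc, div_le_iff₀ hpos'] at h2
  exact h2

/-- Clearing denominators; for `B = 0` the quotient on the right is `∞` or `0`. -/
lemma mul_lt_mul_of_ofReal_lt_mul_div {s A B : ℝ} (hs : 0 ≤ s) (hγ : 0 ≤ γ) (hB : 0 ≤ B)
    (h : ENNReal.ofReal γ < ENNReal.ofReal s * (ENNReal.ofReal A / ENNReal.ofReal B)) :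
    γ * B < s * A := by
  rcases hB.eq_or_lt with rfl | hB
  · have h0 := zero_le.trans_lt h
    have hs' : 0 < s := by
      by_contra hcon
      simp [ENNReal.ofReal_of_nonpos (not_lt.1 hcon)] at h0
    have hA : 0 < A := by
      by_contra hcon
      simp [ENNReal.ofReal_of_nonpos (not_lt.1 hcon)] at h0
    simpa using mul_pos hs' hA
  · rw [← ENNReal.ofReal_div_of_pos hB, ← ENNReal.ofReal_mul hs,
      ENNReal.ofReal_lt_ofReal_iff_of_nonneg hγ, ← mul_div_assoc, lt_div_iff₀ hB] at h
    exact h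

lemma norm_project_sub_le_of_gammaMin_le {P : Fin m → Fin d → ℝ} (hγ : 0 ≤ γ)
    (hpos : ∀ i j, c i = c j → i ≠ j → mu w c (c i) i j < (idx c (c i)).card * w i j)
    (hmin : ENNReal.ofReal √(1 + ε) * gammaMin a w c ≤ ENNReal.ofReal γ)
    (hP : ∀ i j, i ≠ j → NearlyPreserves ε P (a i - a j)) (i j : Fin n) (hij : c i = c j)
    (hne : i ≠ j) :
    ‖project P (a i) - project P (a j)‖
      ≤ γ * ((idx c (c i)).card * w i j - mu w c (c i) i j) := by
  rw [← project_sub]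
  exact (hP i j hne).norm_project_le.trans
    (mul_norm_sub_le_of_gammaMin_le (Real.sqrt_nonneg _) hγ hmin hij (hpos i j hij hne))

theorem mem_recoveryEvent {P : Fin m → Fin d → ℝ} (hw : ∀ i j, w i j = w j i)
    (hw0 : ∀ i j, i ≠ j → 0 ≤ w i j) (hγ : 0 ≤ γ)
    (hpos : ∀ i j, c i = c j → i ≠ j → mu w c (c i) i j < (idx c (c i)).card * w i j)
    (hmin : ENNReal.ofReal √(1 + ε) * gammaMin a w c ≤ ENNReal.ofReal γ)
    (hmax : ENNReal.ofReal γ < ENNReal.ofReal √(1 - ε) * gammaMax a w c)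
    (hP : ∀ i j, i ≠ j → NearlyPreserves ε P (a i - a j))
    (hP' : ∀ α β, α ≠ β → NearlyPreserves ε P (centroid a c α - centroid a c β)) :
    P ∈ recoveryEvent m a w c γ := by
  refine exists_perfectlyRecovers hw hw0 hγ
    (norm_project_sub_le_of_gammaMin_le hγ hpos hmin hP) ?_
  have hlt : ∀ α β, α < β → γ * (wBar w c α + wBar w c β)
      < √(1 - ε) * ‖centroid a c α - centroid a c β‖ := fun α β hαβ =>
    mul_lt_mul_of_ofReal_lt_mul_div (Real.sqrt_nonneg _) hγ
      (add_nonneg (wBar_nonneg hw0 α) (wBar_nonneg hw0 β))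
      (hmax.trans_le (mul_le_mul_right
        ((iInf_le _ α).trans ((iInf_le _ β).trans (iInf_le _ hαβ))) _))
  intro α β hαβ
  rw [centroid_project, centroid_project, ← project_sub]
  refine lt_of_lt_of_le ?_ (hP' α β hαβ).le_norm_project
  rcases lt_or_gt_of_ne hαβ with h | h
  · exact hlt α β h
  · rw [add_comm, norm_sub_rev]
    exact hlt β α h

theorem mem_coarseRecoveryEvent {P : Fin m → Fin d → ℝ} (hw : ∀ i j, w i j = w j i)
    (hw0 : ∀ i j, i ≠ j → 0 ≤ w i j) (hc : Function.Surjective c) (hγ : 0 ≤ γ)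
    (hpos : ∀ i j, c i = c j → i ≠ j → mu w c (c i) i j < (idx c (c i)).card * w i j)
    (hmin : ENNReal.ofReal √(1 + ε) * gammaMin a w c ≤ ENNReal.ofReal γ)
    (hmax : ENNReal.ofReal γ < ENNReal.ofReal √(1 - ε) * gammaMax2 a w c)
    (hP : ∀ i j, i ≠ j → NearlyPreserves ε P (a i - a j))
    (hP' : ∀ α, NearlyPreserves ε P (mean a - centroid a c α)) :
    P ∈ coarseRecoveryEvent m a w c γ := by
  refine exists_recoversNontrivialCoarsening hc hw hw0 hγ
    (norm_project_sub_le_of_gammaMin_le hγ hpos hmin hP) ?_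
  rw [gammaMax2, ENNReal.mul_iSup, lt_iSup_iff] at hmax
  obtain ⟨α, hα⟩ := hmax
  refine ⟨α, ?_⟩
  rw [centroid_project, mean_project, ← project_sub]
  exact (mul_lt_mul_of_ofReal_lt_mul_div (Real.sqrt_nonneg _) hγ (wBar_nonneg hw0 α) hα).trans_le
    (hP' α).le_norm_project

end Projection

/-! ### The union bound -/

section UnionBound

variable {m n d K : ℕ} {ε δ : ℝ} {D : Measure (Fin m → Fin d → ℝ)}

lemma IsDJL.real_not_nearlyPreserves_le (hD : IsDJL D ε δ) (hδ : 0 ≤ δ)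
    (z : EuclideanSpace ℝ (Fin d)) : D.real {P | ¬NearlyPreserves ε P z} ≤ δ := by
  rcases eq_or_ne z 0 with rfl | hz
  · simpa [NearlyPreserves, project] using hδ
  · have hz' : 0 < ‖z‖ := norm_pos_iff.2 hz
    have := hD.isProbabilityMeasure
    refine (measureReal_mono fun P hP => ?_).trans
      (hD.distortion (‖z‖⁻¹ • z) (by rw [norm_smul, norm_inv, norm_norm,
        inv_mul_cancel₀ hz'.ne'])).le
    have hP' : ε * ‖z‖ ^ 2 < |‖project P z‖ ^ 2 - ‖z‖ ^ 2| := not_le.1 hP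
    change ε < |‖project P (‖z‖⁻¹ • z)‖ ^ 2 - 1|
    have e : ‖project P z‖ ^ 2 - ‖z‖ ^ 2
        = (‖project P (‖z‖⁻¹ • z)‖ ^ 2 - 1) * ‖z‖ ^ 2 := by
      rw [project_smul, norm_smul, norm_inv, norm_norm]
      field_simp
    rw [e, abs_mul, abs_of_pos (pow_pos hz' 2)] at hP'
    exact lt_of_mul_lt_mul_right hP' (sq_nonneg _)

/-- The set `S` need not be measurable: only the subadditivity of the outer measure
is used. -/
theorem IsDJL.one_sub_le_real_of_subset (hD : IsDJL D ε δ) (hδ : 0 ≤ δ)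
    (T : Finset (EuclideanSpace ℝ (Fin d))) {S : Set (Fin m → Fin d → ℝ)}
    (hS : ∀ P, (∀ z ∈ T, NearlyPreserves ε P z) → P ∈ S) : 1 - T.card * δ ≤ D.real S := by
  have := hD.isProbabilityMeasure
  have hcover : (Set.univ : Set (Fin m → Fin d → ℝ))
      ⊆ S ∪ ⋃ z ∈ T, {P | ¬NearlyPreserves ε P z} := by
    intro P _
    by_cases h : ∀ z ∈ T, NearlyPreserves ε P z
    · exact Or.inl (hS P h)
    · right
      push Not at h
      obtain ⟨z, hz, hzP⟩ := h
      exact Set.mem_biUnion hz hzP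
  have h1 : (1 : ℝ) ≤ D.real S + D.real (⋃ z ∈ T, {P | ¬NearlyPreserves ε P z}) := by
    rw [← probReal_univ (μ := D)]
    exact (measureReal_mono hcover).trans (measureReal_union_le _ _)
  have h2 : D.real (⋃ z ∈ T, {P | ¬NearlyPreserves ε P z}) ≤ T.card * δ := by
    refine (measureReal_biUnion_finset_le _ _).trans ?_
    rw [← nsmul_eq_mul]
    exact Finset.sum_le_card_nsmul _ _ _ fun z _ => hD.real_not_nearlyPreserves_le hδ z
  linarith

/-- The set of pairs `(i, j)` with `i < j`. -/
def ltPairs (n : ℕ) : Finset (Fin n × Fin n) := Finset.univ.filter fun q => q.1 < q.2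

lemma two_mul_card_ltPairs (n : ℕ) : 2 * (ltPairs n).card + n = n * n := by
  have h1 : (Finset.univ : Finset (Fin n)).offDiag
      = ltPairs n ∪ (ltPairs n).map (Equiv.prodComm _ _).toEmbedding := by
    ext ⟨i, j⟩
    simp only [ltPairs, Finset.mem_offDiag, Finset.mem_univ, true_and, Finset.mem_union,
      Finset.mem_filter, Finset.mem_map_equiv, Equiv.prodComm_symm, Equiv.prodComm_apply,
      Prod.swap]
    exact ne_iff_lt_or_gt
  have h2 : Disjoint (ltPairs n) ((ltPairs n).map (Equiv.prodComm _ _).toEmbedding) := by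
    rw [Finset.disjoint_left]
    rintro ⟨i, j⟩ h h'
    simp only [ltPairs, Finset.mem_univ, true_and, Finset.mem_filter, Finset.mem_map_equiv,
      Equiv.prodComm_symm, Equiv.prodComm_apply, Prod.swap] at h h'
    exact lt_asymm h h'
  have h3 := congrArg Finset.card h1
  rw [Finset.card_union_of_disjoint h2, Finset.card_map, Finset.offDiag_card, Finset.card_univ,
    Fintype.card_fin] at h3
  have := Nat.le_mul_self n
  omega

open Classical in
/-- The vectors whose lengths have to be preserved: the differences of the data points, those of
the centroids, and those of the overall mean and the centroids. -/
def testVectors (a : Fin n → EuclideanSpace ℝ (Fin d)) (c : Fin n → Fin K) :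
    Finset (EuclideanSpace ℝ (Fin d)) :=
  (ltPairs n).image (fun q => a q.1 - a q.2) ∪
    ((ltPairs K).image (fun q => centroid a c q.1 - centroid a c q.2) ∪
      Finset.univ.image fun α => mean a - centroid a c α)

lemma two_mul_card_testVectors_lt {a : Fin n → EuclideanSpace ℝ (Fin d)} {c : Fin n → Fin K}
    (hK : K * (K + 1) < n) : 2 * (testVectors a c).card < n * n := by
  classical
  have h1 : (testVectors a c).card ≤ (ltPairs n).card + ((ltPairs K).card + K) := by
    refine (Finset.card_union_le _ _).trans (add_le_add Finset.card_image_le ?_)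
    refine (Finset.card_union_le _ _).trans (add_le_add Finset.card_image_le ?_)
    exact Finset.card_image_le.trans (by simp)
  have h2 := two_mul_card_ltPairs n
  have h3 := two_mul_card_ltPairs K
  rw [mul_add, mul_one] at hK
  omega

/-- There are fewer than `n² / 2` test vectors, and for each of them the failure probability is
at most `2 / n ^ p`. -/
theorem IsDJL.one_sub_lt_real_of_testVectors {a : Fin n → EuclideanSpace ℝ (Fin d)}
    {c : Fin n → Fin K} {p : ℝ} (hD : IsDJL D ε (2 / (n : ℝ) ^ p)) (hK : K * (K + 1) < n)
    {S : Set (Fin m → Fin d → ℝ)}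
    (hS : ∀ P, (∀ i j, i ≠ j → NearlyPreserves ε P (a i - a j)) →
      (∀ α β, α ≠ β → NearlyPreserves ε P (centroid a c α - centroid a c β)) →
      (∀ α, NearlyPreserves ε P (mean a - centroid a c α)) → P ∈ S) :
    1 - 1 / (n : ℝ) ^ (p - 2) < D.real S := by
  have hn : (0 : ℝ) < n := Nat.cast_pos.2 (by omega)
  have hnp : 0 < (n : ℝ) ^ p := Real.rpow_pos_of_pos hn p
  refine lt_of_lt_of_le ?_ (hD.one_sub_le_real_of_subset (by positivity) (testVectors a c)
    fun P hP => hS P ?_ ?_ ?_)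
  · have hcard : 2 * ((testVectors a c).card : ℝ) < n * n := by
      exact_mod_cast two_mul_card_testVectors_lt hK
    rw [Real.rpow_sub hn, one_div_div, Real.rpow_two, sub_lt_sub_iff_left, ← mul_div_assoc]
    exact div_lt_div_of_pos_right (by nlinarith) hnp
  · intro i j hij
    have hlt : ∀ i j, i < j → NearlyPreserves ε P (a i - a j) := fun i j h =>
      hP _ (by
        simp only [testVectors, Finset.mem_union, Finset.mem_image]
        exact Or.inl ⟨(i, j), by simpa [ltPairs] using h, rfl⟩)
    rcases lt_or_gt_of_ne hij with h | h
    exacts [hlt i j h, (hlt j i h).sub_comm]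
  · intro α β hαβ
    have hlt : ∀ α β, α < β → NearlyPreserves ε P (centroid a c α - centroid a c β) :=
      fun α β h => hP _ (by
        simp only [testVectors, Finset.mem_union, Finset.mem_image]
        exact Or.inr (Or.inl ⟨(α, β), by simpa [ltPairs] using h, rfl⟩))
    rcases lt_or_gt_of_ne hαβ with h | h
    exacts [hlt α β h, (hlt β α h).sub_comm]
  · intro α
    exact hP _ (by simp [testVectors])

end UnionBound

/-! ### The admissible distortions -/

lemma lt_epsSup {e : ℝ} (he1 : e < 1) {r : ℝ≥0∞}
    (h : ENNReal.ofReal √((1 + e) / (1 - e)) < r) : e < epsSup r := by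
  rw [epsSup]
  split_ifs with hr
  · exact he1
  · have h1 := (ENNReal.ofReal_lt_iff_lt_toReal (Real.sqrt_nonneg _) hr).1 h
    rw [Real.sqrt_lt' ((Real.sqrt_nonneg _).trans_lt h1), div_lt_iff₀ (by linarith)] at h1
    rw [lt_div_iff₀ (by positivity)]
    linarith

end ConvexClustering

end

/-! ### Existence of DJL distributions, and recovery with high probability -/

open ConvexClustering in
theorem mainTheorem1 :
    -- DJL distributions with `m = O(p ε⁻² log n)` and `δ = 2 / n ^ p` exist
    (∃ C₀ : ℝ, 0 < C₀ ∧ ∀ (n d : ℕ) (p ε : ℝ), 2 ≤ n → 2 < p → 0 < ε → ε < 1 →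
      ∃ m : ℕ, (m : ℝ) ≤ C₀ * p * Real.log n / ε ^ 2 ∧
        ∃ D : Measure (Fin m → Fin d → ℝ), IsDJL D ε (2 / (n : ℝ) ^ p)) ∧
    -- recovery, for every value `C` of the constant in `O`
    (∀ (C : ℝ) (_ : 0 < C) (n d K : ℕ) (a : Fin n → EuclideanSpace ℝ (Fin d))
      (c : Fin n → Fin K) (w : Fin n → Fin n → ℝ) (p : ℝ)
      (_ : Function.Surjective c)
      (_ : ∀ i j, w i j = w j i)
      (_ : ∀ i j, i ≠ j → 0 ≤ w i j)
      (_ : Function.Injective (centroid a c))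
      (_ : ∀ α, mean a ≠ centroid a c α)
      (_ : ∀ α, ∀ i ∈ idx c α, ∀ j ∈ idx c α, i ≠ j →
        0 < w i j ∧ mu w c α i j < ((idx c α).card : ℝ) * w i j)
      (_ : K * (K + 1) < n)
      (_ : 2 < p)
      (_ : epsMin C p n d < 1),
      (ENNReal.ofReal (Real.sqrt ((1 + epsMin C p n d) / (1 - epsMin C p n d))) < ratio a w c →
        epsMin C p n d < epsSup (ratio a w c) ∧
        ∀ ε : ℝ, epsMin C p n d ≤ ε → ε < epsSup (ratio a w c) →
        ∀ m : ℕ, (m : ℝ) ≤ C * p * Real.log n / ε ^ 2 →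
        ∀ D : Measure (Fin m → Fin d → ℝ), IsDJL D ε (2 / (n : ℝ) ^ p) →
        ∀ γ : ℝ, 0 ≤ γ →
          ENNReal.ofReal (Real.sqrt (1 + ε)) * gammaMin a w c ≤ ENNReal.ofReal γ →
          ENNReal.ofReal γ < ENNReal.ofReal (Real.sqrt (1 - ε)) * gammaMax a w c →
          1 - 1 / (n : ℝ) ^ (p - 2) < D.real (recoveryEvent m a w c γ)) ∧
      (ENNReal.ofReal (Real.sqrt ((1 + epsMin C p n d) / (1 - epsMin C p n d))) < ratio2 a w c →
        epsMin C p n d < epsSup (ratio2 a w c) ∧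
        ∀ ε : ℝ, epsMin C p n d ≤ ε → ε < epsSup (ratio2 a w c) →
        ∀ m : ℕ, (m : ℝ) ≤ C * p * Real.log n / ε ^ 2 →
        ∀ D : Measure (Fin m → Fin d → ℝ), IsDJL D ε (2 / (n : ℝ) ^ p) →
        ∀ γ : ℝ, 0 ≤ γ →
          ENNReal.ofReal (Real.sqrt (1 + ε)) * gammaMin a w c ≤ ENNReal.ofReal γ →
          ENNReal.ofReal γ < ENNReal.ofReal (Real.sqrt (1 - ε)) * gammaMax2 a w c →
          1 - 1 / (n : ℝ) ^ (p - 2) < D.real (coarseRecoveryEvent m a w c γ))) := by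
  refine ⟨⟨17, by norm_num, fun n d p ε hn hp hε hε1 => exists_isDJL hn hp hε hε1⟩, ?_⟩
  intro C _ n d K a c w p hc hw hw0 _ _ hpos hK _ he1
  have hpos' : ∀ i j, c i = c j → i ≠ j → mu w c (c i) i j < (idx c (c i)).card * w i j :=
    fun i j hij hne => (hpos (c i) i (by simp) j (by simp [hij]) hne).2
  refine ⟨fun hr => ⟨lt_epsSup he1 hr, ?_⟩,
    fun hr => ⟨lt_epsSup he1 hr, ?_⟩⟩
  · intro ε _ _ m _ D hD γ hγ hmin hmax
    exact hD.one_sub_lt_real_of_testVectors hK fun P hP hP' _ =>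
      mem_recoveryEvent hw hw0 hγ hpos' hmin hmax hP hP'
  · intro ε _ _ m _ D hD γ hγ hmin hmax
    exact hD.one_sub_lt_real_of_testVectors hK fun P hP _ hP' =>
      mem_coarseRecoveryEvent hw hw0 hc hγ hpos' hmin hmax hP hP'
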